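/- Let $\mathcal K=\{1,\dots,K\}$ be a finite set of goods; subsets of $\mathcal K$ are called bundles, and $Ai$, $Aij$, … denote $A\cup\{i\}$, $A\cup\{i,j\}$, … for distinct goods outside $A$. An \emph{interaction function} is a function $\theta:2^{\mathcal K}\to\mathbb R$ with $\theta(A)=0$ whenever $|A|\le 1$. It satisfies $S3_\theta$ if, for every bundle $A$ and distinct goods $i,j,k\notin A$, at least two of the numbers $\theta(Aij)+\theta(Ak)$, $\theta(Aik)+\theta(Aj)$, $\theta(Ajk)+\theta(Ai)$ are equal to the minimum of the three. It is supermodular if $\theta(A\cup B)+\theta(A\cap B)\ge\theta(A)+\theta(B)$ for all bundles $A,B$. For interaction functions write $\theta\preceq\theta'$ if $\theta=\theta'$, or if there is a level $L$ with $2\le L\le K$ such that $\theta(A)=\theta'(A)$ for $|A|<L$, $\theta(A)\le\theta'(A)$ for $|A|=L$, and $\theta(A_0)<\theta'(A_0)$ for some $A_0$ with $|A_0|=L$ (the level-lexicographic order). A function $v:2^{\mathcal K}\to\mathbb R$ with $v(\emptyset)=0$ is a \emph{substitute valuation} if, for all price vectors $p\le q$ in $\mathbb R_+^K$ and every $A\in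 D(p)=\arg\max_B\,(v(B)-\sum_{k\in B}p_k)$, there is $A'\in D(q)$ with $\{k\in A:p_k=q_k\}\subseteq A'$. Consider the following algorithm, started from an integer-valued interaction function $\theta_o$ and an integer vector $\mu_o\in\mathbb Z^{\mathcal K}$. 1. Set $\theta:=\theta_o$. 2. For $L=2,\dots,K$ in turn (phase $L$): (a) for every bundle $A$ with $|A|=L-2$ and all distinct $i,j\notin A$, execute $\theta(Aij):=\max\{\theta(Aij),\ \theta(Ai)+\theta(Aj)-\theta(A)\}$; (b) perform iterations, each of which executes, for every bundle $A$ with $|A|=L-2$ and all distinct $i,j,k\notin A$, the statement $\theta(Aij):=\max\{\theta(Aij),\ \min\{\theta(Aik)+\theta(Aj),\ \theta(Ajk)+\theta(Ai)\}-\theta(Ak)\}$, until an iteration makes no change. 3. For every good $k$ set $\mu(k):=\max\{\mu_o(k),\ \max_{A:\,k\notin A}(\theta(Ak)-\theta(A))\}$, and output $\theta$ and $\mu$. The order in which the statements of each of the loops in (a), in each iteration of (b), and in step 3 are executed is arbitrary. Then, whatever these orders are, the algorithm halts after finitely many steps, and its output $(\theta,\mu)$ has the following properties. The function $v(A)=\sum_{k\in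 A}\mu(k)-\theta(A)$ is a nondecreasing substitute valuation. The function $\theta$ is a supermodular interaction function that satisfies $S3_\theta$ and pointwise dominates $\theta_o$, and among all (real-valued) such functions it is the minimum with respect to $\preceq$: every supermodular interaction function $\theta'$ satisfying $S3_\theta$ and pointwise dominating $\theta_o$ satisfies $\theta\preceq\theta'$; in particular $\theta$ is minimal, that is, $\theta'\preceq\theta$ only if $\theta'=\theta$. -/

import Mathlib

namespace SubstituteGen

/-- A bundle of goods; the goods are the elements of `Fin K`. -/
abbrev Bundle (K : ℕ) : Type := Finset (Fin K)

/-! ### Valuations and the substitute property -/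

/-- The payoff `v(A) - p · A` of the bundle `A` at the price vector `p`. -/
def payoff {K : ℕ} (v : Bundle K → ℝ) (p : Fin K → ℝ) (A : Bundle K) : ℝ :=
  v A - ∑ k ∈ A, p k

/-- The demand correspondence `D(p) = argmax_A (v(A) - p · A)`. -/
def demand {K : ℕ} (v : Bundle K → ℝ) (p : Fin K → ℝ) : Set (Bundle K) :=
  {A | ∀ B : Bundle K, payoff v p B ≤ payoff v p A}

/-- A substitute valuation: normalized at the empty bundle, and whenever nonnegative prices rise
from `p` to `q`, every bundle demanded at `p` has its items with unchanged price contained in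
some bundle demanded at `q`. -/
def IsSubstituteValuation {K : ℕ} (v : Bundle K → ℝ) : Prop :=
  v ∅ = 0 ∧
  ∀ p q : Fin K → ℝ, (∀ k, 0 ≤ p k) → (∀ k, p k ≤ q k) →
    ∀ A ∈ demand v p, ∃ A' ∈ demand v q, ∀ k ∈ A, p k = q k → k ∈ A'

/-! ### Interaction functions -/

/-- An interaction function vanishes on bundles with at most one good. -/
def IsInteractionFunction {K : ℕ} (θ : Bundle K → ℝ) : Prop :=
  ∀ A : Bundle K, A.card ≤ 1 → θ A = 0

/-- Supermodularity: `θ(A ∪ B) - θ(A) - θ(B) + θ(A ∩ B) ≥ 0` for all bundles `A`, `B`. -/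
def IsSupermodular {K : ℕ} (θ : Bundle K → ℝ) : Prop :=
  ∀ A B : Bundle K, θ A + θ B ≤ θ (A ∪ B) + θ (A ∩ B)

/-- At least two of the three numbers are equal to their minimum. -/
def DoubleMin (x y z : ℝ) : Prop :=
  min y z ≤ x ∧ min x z ≤ y ∧ min x y ≤ z

/-- The property `S3_θ(L)`; the condition `|A| = L - 2` is written `|A| + 2 = L`. -/
def S3Level {K : ℕ} (L : ℕ) (θ : Bundle K → ℝ) : Prop :=
  ∀ (A : Bundle K) (i j k : Fin K), A.card + 2 = L →
    i ∉ A → j ∉ A → k ∉ A → i ≠ j → i ≠ k → j ≠ k →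
    DoubleMin
      (θ (insert i (insert j A)) + θ (insert k A))
      (θ (insert i (insert k A)) + θ (insert j A))
      (θ (insert j (insert k A)) + θ (insert i A))

/-- The property `S3_θ`: the property `S3_θ(L)` for `2 ≤ L ≤ K - 1`. -/
def S3 {K : ℕ} (θ : Bundle K → ℝ) : Prop :=
  ∀ L : ℕ, 2 ≤ L → L + 1 ≤ K → S3Level L θ

/-- The supermodular interaction functions satisfying `S3_θ` that pointwise dominate `θo`. -/
def Feasible {K : ℕ} (θo : Bundle K → ℝ) : Set (Bundle K → ℝ) :=
  {θ | IsInteractionFunction θ ∧ IsSupermodular θ ∧ S3 θ ∧ ∀ A, θo A ≤ θ A}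

/-- The level-lexicographic order, `θ` being at or below `θ'`: they are equal, or at some level
`L` they agree on all smaller bundles, `θ` is pointwise at most `θ'` on the bundles of size `L`,
and strictly less on at least one of these. -/
def LevelLexLE {K : ℕ} (θ θ' : Bundle K → ℝ) : Prop :=
  θ = θ' ∨
  ∃ L : ℕ, 2 ≤ L ∧ L ≤ K ∧
    (∀ A : Bundle K, A.card < L → θ A = θ' A) ∧
    (∀ A : Bundle K, A.card = L → θ A ≤ θ' A) ∧
    ∃ A₀ : Bundle K, A₀.card = L ∧ θ A₀ < θ' A₀

/-! ### The generation algorithm, as a small-step machine on integer data -/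

/-- The index set of the first part of phase `L`: all `(A, i, j)` with `|A| = L - 2` and
distinct goods `i, j` outside `A`. -/
def pairTasks (K L : ℕ) : Finset (Bundle K × Fin K × Fin K) :=
  Finset.univ.filter fun t => t.1.card + 2 = L ∧
    t.2.1 ∉ t.1 ∧ t.2.2 ∉ t.1 ∧ t.2.1 ≠ t.2.2

/-- The index set of an iteration in the second part of phase `L`: all `(A, i, j, k)` with
`|A| = L - 2` and distinct goods `i, j, k` outside `A`. -/
def tripleTasks (K L : ℕ) : Finset (Bundle K × Fin K × Fin K × Fin K) :=
  Finset.univ.filter fun t => t.1.card + 2 = L ∧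
    t.2.1 ∉ t.1 ∧ t.2.2.1 ∉ t.1 ∧ t.2.2.2 ∉ t.1 ∧
    t.2.1 ≠ t.2.2.1 ∧ t.2.1 ≠ t.2.2.2 ∧ t.2.2.1 ≠ t.2.2.2

/-- The statement `θ(Aij) := max {θ(Aij), θ(Ai) + θ(Aj) - θ(A)}`. -/
def pairUpdate {K : ℕ} (θ : Bundle K → ℤ) (t : Bundle K × Fin K × Fin K) : Bundle K → ℤ :=
  match t with
  | (A, i, j) =>
    Function.update θ (insert i (insert j A))
      (max (θ (insert i (insert j A))) (θ (insert i A) + θ (insert j A) - θ A))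

/-- The statement
`θ(Aij) := max {θ(Aij), min {θ(Aik) + θ(Aj), θ(Ajk) + θ(Ai)} - θ(Ak)}`. -/
def tripleUpdate {K : ℕ} (θ : Bundle K → ℤ) (t : Bundle K × Fin K × Fin K × Fin K) :
    Bundle K → ℤ :=
  match t with
  | (A, i, j, k) =>
    Function.update θ (insert i (insert j A))
      (max (θ (insert i (insert j A)))
        (min (θ (insert i (insert k A)) + θ (insert j A))
             (θ (insert j (insert k A)) + θ (insert i A)) - θ (insert k A)))

/-- The bundles that do not contain the good `k`. -/
def bundlesWithout {K : ℕ} (k : Fin K) : Finset (Bundle K) :=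
  Finset.univ.filter fun A => k ∉ A

theorem bundlesWithout_nonempty {K : ℕ} (k : Fin K) : (bundlesWithout k).Nonempty :=
  ⟨∅, by simp [bundlesWithout]⟩

/-- `max_{A : k ∉ A} (θ(Ak) - θ(A))`. -/
def maxMarginal {K : ℕ} (θ : Bundle K → ℤ) (k : Fin K) : ℤ :=
  (bundlesWithout k).sup' (bundlesWithout_nonempty k) fun A => θ (insert k A) - θ A

/-- The configurations of the algorithm. `todo` is the set of statements that the current loop
still has to execute; `changed` records whether the current iteration has changed `θ`. -/
inductive Config (K : ℕ) : Type
  /-- First part of phase `L`. -/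
  | part1 (L : ℕ) (todo : Finset (Bundle K × Fin K × Fin K)) (θ : Bundle K → ℤ)
  /-- An iteration in the second part of phase `L`. -/
  | part2 (L : ℕ) (todo : Finset (Bundle K × Fin K × Fin K × Fin K)) (changed : Bool)
      (θ : Bundle K → ℤ)
  /-- The loop over the goods that computes `μ`. -/
  | part3 (todo : Finset (Fin K)) (θ : Bundle K → ℤ) (μ : Fin K → ℤ)
  /-- The algorithm has halted with output `θ`, `μ`. -/
  | halted (θ : Bundle K → ℤ) (μ : Fin K → ℤ)

/-- Head of the loop `for 2 ≤ L ≤ K`: begin phase `L`, or leave the loop if `L > K`. -/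
def enterPhase {K : ℕ} (μo : Fin K → ℤ) (L : ℕ) (θ : Bundle K → ℤ) : Config K :=
  if L ≤ K then Config.part1 L (pairTasks K L) θ else Config.part3 Finset.univ θ μo

/-- The initial configuration for the data `θo`, `μo`. -/
def start {K : ℕ} (θo : Bundle K → ℤ) (μo : Fin K → ℤ) : Config K :=
  enterPhase μo 2 θo

/-- One elementary step of the algorithm. Inside each loop the statements are executed once
each, in an arbitrary order. -/
inductive Step {K : ℕ} (μo : Fin K → ℤ) : Config K → Config K → Prop
  | pair (L : ℕ) (todo : Finset (Bundle K × Fin K × Fin K)) (θ : Bundle K → ℤ)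
      (t : Bundle K × Fin K × Fin K) (ht : t ∈ todo) :
      Step μo (.part1 L todo θ) (.part1 L (todo.erase t) (pairUpdate θ t))
  | pairsDone (L : ℕ) (θ : Bundle K → ℤ) :
      Step μo (.part1 L ∅ θ) (.part2 L (tripleTasks K L) false θ)
  | triple (L : ℕ) (todo : Finset (Bundle K × Fin K × Fin K × Fin K)) (changed : Bool)
      (θ : Bundle K → ℤ) (t : Bundle K × Fin K × Fin K × Fin K) (ht : t ∈ todo) :
      Step μo (.part2 L todo changed θ)
        (.part2 L (todo.erase t) (changed || decide (tripleUpdate θ t ≠ θ)) (tripleUpdate θ t))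
  /-- The iteration made a change: run another one. -/
  | again (L : ℕ) (θ : Bundle K → ℤ) :
      Step μo (.part2 L ∅ true θ) (.part2 L (tripleTasks K L) false θ)
  /-- The iteration made no change: phase `L` is complete. -/
  | phaseDone (L : ℕ) (θ : Bundle K → ℤ) :
      Step μo (.part2 L ∅ false θ) (enterPhase μo (L + 1) θ)
  | setMu (todo : Finset (Fin K)) (θ : Bundle K → ℤ) (μ : Fin K → ℤ) (k : Fin K)
      (hk : k ∈ todo) :
      Step μo (.part3 todo θ μ)
        (.part3 (todo.erase k) θ (Function.update μ k (max (μo k) (maxMarginal θ k))))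
  | halt (θ : Bundle K → ℤ) (μ : Fin K → ℤ) :
      Step μo (.part3 ∅ θ μ) (.halted θ μ)

/-- The configurations that occur in some execution from the data `θo`, `μo`. -/
def Reachable {K : ℕ} (θo : Bundle K → ℤ) (μo : Fin K → ℤ) (c : Config K) : Prop :=
  Relation.ReflTransGen (Step μo) (start θo μo) c

/-- An integer-valued set function as a real-valued one. -/
def toReal {K : ℕ} (θ : Bundle K → ℤ) : Bundle K → ℝ := fun A => (θ A : ℝ)

/-- The output valuation `v(A) = μ · A - θ(A)`. -/
def outputValuation {K : ℕ} (θ : Bundle K → ℤ) (μ : Fin K → ℤ) : Bundle K → ℝ :=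
  fun A => (∑ k ∈ A, (μ k : ℝ)) - (θ A : ℝ)

end SubstituteGen

namespace SubstituteGen

/-! For every base `A`, the completed phases make `θ` pairwise supermodular and make `g(ij) = θ(Aij)
- θ(Ai) - θ(Aj)` satisfy `g(ij) ≥ min (g(ik), g(jk))`, an ultrametric-type condition equivalent to
`S3`. In terms of `-θ` this is `LocalExchange`, which is unaffected by adding linear terms.
`LocalExchange.exchange` globalizes it to an exchange between two arbitrary bundles, which yields
the substitute property for one price rise (`LocalExchange.demand_update`) and hence for all. The
vector `μ` matters only for monotonicity.

Minimality: a statement of phase `L` depends monotonically on values of size `L` and otherwise reads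
smaller bundles. If a feasible `θ'` agrees with `θ` below `L` and dominates it at `L`, then its own
inequality keeps it dominant after the statement (`PhaseInv.raise`). Comparing at the first level of
disagreement gives the order relation.

Termination: the values are integers and only rise, so an upper bound within each phase suffices.
`PhaseInv.exists_bound` builds one from the finished level below; it works because the triple
inequalities there imply the four-point inequality (`four_point`), as an ultrametric is a tree
metric. -/

/-! ### From local to global exchange. -/

/-- The local exchange inequalities characterizing gross substitutes. -/
structure LocalExchange {K : ℕ} (f : Bundle K → ℝ) : Prop where
  pair : ∀ (A : Bundle K) (i j : Fin K), i ∉ A → j ∉ A → i ≠ j →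
    f (insert i (insert j A)) + f A ≤ f (insert i A) + f (insert j A)
  triple : ∀ (A : Bundle K) (i j k : Fin K), i ∉ A → j ∉ A → k ∉ A → i ≠ j → i ≠ k → j ≠ k →
    f (insert i (insert j A)) + f (insert k A) ≤ f (insert i (insert k A)) + f (insert j A) ∨
    f (insert i (insert j A)) + f (insert k A) ≤ f (insert j (insert k A)) + f (insert i A)

/-- The four-point inequality over a base `A`, from the triple inequalities over `A` alone. -/
theorem four_point {K : ℕ} (f : Bundle K → ℝ) (A : Bundle K)
    (hf : ∀ i j k : Fin K, i ∉ A → j ∉ A → k ∉ A → i ≠ j → i ≠ k → j ≠ k →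
      f (insert i (insert j A)) + f (insert k A) ≤ f (insert i (insert k A)) + f (insert j A) ∨
      f (insert i (insert j A)) + f (insert k A) ≤ f (insert j (insert k A)) + f (insert i A))
    {i j k l : Fin K} (hi : i ∉ A) (hj : j ∉ A) (hk : k ∉ A) (hl : l ∉ A)
    (hij : i ≠ j) (hik : i ≠ k) (hil : i ≠ l) (hjk : j ≠ k) (hjl : j ≠ l) (hkl : k ≠ l) :
    f (insert i (insert j A)) + f (insert k (insert l A)) ≤
        f (insert i (insert k A)) + f (insert j (insert l A)) ∨
      f (insert i (insert j A)) + f (insert k (insert l A)) ≤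
        f (insert i (insert l A)) + f (insert j (insert k A)) := by
  have h1 := hf i j k hi hj hk hij hik hjk
  have h2 := hf i j l hi hj hl hij hil hjl
  have h3 := hf k l i hk hl hi hkl hik.symm hil.symm
  have h4 := hf k l j hk hl hj hkl hjk.symm hjl.symm
  rw [Finset.insert_comm k i, Finset.insert_comm l i] at h3
  rw [Finset.insert_comm k j, Finset.insert_comm l j] at h4
  by_contra! h
  obtain ⟨h5, h6⟩ := h
  rcases h1 with h1 | h1 <;> rcases h2 with h2 | h2 <;> rcases h3 with h3 | h3 <;>
    rcases h4 with h4 | h4 <;> linarith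

namespace LocalExchange

variable {K : ℕ} {f : Bundle K → ℝ} (hf : LocalExchange f)
include hf

theorem pair_add {B : Bundle K} {u k : Fin K} (hu : u ∉ B) (hk : k ∉ B) (huk : u ≠ k) :
    f (insert k (insert u B)) + f B ≤ f (insert u B) + f (insert k B) := by
  linarith [hf.pair B k u hk hu huk.symm]

theorem triple_add_erase {B : Bundle K} {u k b : Fin K} (hb : b ∈ B) (hu : u ∉ B) (hk : k ∉ B)
    (huk : u ≠ k) :
    f (insert k (insert u (B.erase b))) + f B ≤ f (insert u B) + f (insert k (B.erase b)) ∨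
    f (insert k (insert u (B.erase b))) + f B ≤ f (insert k B) + f (insert u (B.erase b)) := by
  have h := hf.triple (B.erase b) u k b (by simp [hu]) (by simp [hk]) (by simp) huk
    (by rintro rfl; exact hu hb) (by rintro rfl; exact hk hb)
  rwa [Finset.insert_erase hb, Finset.insert_comm u k] at h

theorem triple_erase_erase {B : Bundle K} {k b c : Fin K} (hb : b ∈ B) (hc : c ∈ B) (hk : k ∉ B)
    (hbc : b ≠ c) :
    f (insert k ((B.erase b).erase c)) + f B ≤ f (insert k (B.erase b)) + f (B.erase c) ∨
    f (insert k ((B.erase b).erase c)) + f B ≤ f (insert k (B.erase c)) + f (B.erase b) := by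
  have h := hf.triple ((B.erase b).erase c) b c k (by simp) (by simp) (by simp [hk]) hbc
    (by rintro rfl; exact hk hb) (by rintro rfl; exact hk hc)
  have e1 : insert c ((B.erase b).erase c) = B.erase b :=
    Finset.insert_erase (by simp [hc, hbc.symm])
  have e2 : insert b ((B.erase b).erase c) = B.erase c := by
    rw [Finset.erase_right_comm]; exact Finset.insert_erase (by simp [hb, hbc])
  rw [Finset.insert_comm b k, Finset.insert_comm c k, e1, e2, Finset.insert_erase hb] at h
  rcases h with h | h
  · right; linarith
  · left; linarith

theorem four_erase_erase {B : Bundle K} {u k b c : Fin K} (hb : b ∈ B) (hc : c ∈ B) (hu : u ∉ B)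
    (hk : k ∉ B) (huk : u ≠ k) (hbc : b ≠ c) :
    f (insert k (insert u ((B.erase b).erase c))) + f B ≤
      f (insert k (B.erase b)) + f (insert u (B.erase c)) ∨
    f (insert k (insert u ((B.erase b).erase c))) + f B ≤
      f (insert k (B.erase c)) + f (insert u (B.erase b)) := by
  have h := four_point f ((B.erase b).erase c) (hf.triple _) (i := k) (j := u) (k := c) (l := b)
    (by simp [hk]) (by simp [hu]) (by simp) (by simp) huk.symm
    (by rintro rfl; exact hk hc) (by rintro rfl; exact hk hb)
    (by rintro rfl; exact hu hc) (by rintro rfl; exact hu hb) hbc.symm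
  have e1 : insert c ((B.erase b).erase c) = B.erase b :=
    Finset.insert_erase (by simp [hc, hbc.symm])
  have e2 : insert b ((B.erase b).erase c) = B.erase c := by
    rw [Finset.erase_right_comm]; exact Finset.insert_erase (by simp [hb, hbc])
  rwa [Finset.insert_comm c b, e1, e2, Finset.insert_erase hb] at h

/-- The case `A \ B = {k}` of `exchange`, by removing from `B` a good `c` whose loss hurts least. An
exchange available at `B - c` is carried back to `B` by the triple inequality over `B - b - c`. -/
theorem exchange_superset {A : Bundle K} {k : Fin K} (hkA : k ∈ A) (n : ℕ) :
    ∀ B : Bundle K, (B \ A).card = n + 1 → k ∉ B → A.erase k ⊆ B →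
      (∀ b ∈ B \ A, f (insert b (A.erase k)) ≤ f A) →
      ∃ b ∈ B \ A, f B ≤ f (insert k (B.erase b)) := by
  induction n with
  | zero =>
    intro B hn hkB hAB hA
    obtain ⟨b, hb⟩ := Finset.card_eq_one.mp hn
    have hbm : b ∈ B \ A := by simp [hb]
    have hbm' := Finset.mem_sdiff.mp hbm
    have hB : B = insert b (A.erase k) := by
      ext x
      have hx : x ∈ B \ A ↔ x = b := by simp [hb]
      by_cases hxk : x = k
      · subst hxk
        simp [hkB]; rintro rfl; exact hkB hbm'.1
      · have := @hAB x
        simp only [Finset.mem_sdiff, Finset.mem_insert, Finset.mem_erase] at *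
        tauto
    refine ⟨b, hbm, ?_⟩
    have hb' : b ∉ A.erase k := by simp [hbm'.2]
    have : insert k (B.erase b) = A := by
      rw [hB, Finset.erase_insert hb', Finset.insert_erase hkA]
    rw [this]
    calc f B = f (insert b (A.erase k)) := by rw [← hB]
      _ ≤ f A := hA b hbm
  | succ n ih =>
    intro B hn hkB hAB hA
    by_contra! hlt
    obtain ⟨c, hc, hmax⟩ := Finset.exists_max_image (B \ A) (fun b => f (B.erase b))
      (Finset.card_pos.mp (by omega))
    have hc' := Finset.mem_sdiff.mp hc
    have hsd : (B.erase c) \ A = (B \ A).erase c := by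
      ext x; simp only [Finset.mem_sdiff, Finset.mem_erase]; tauto
    obtain ⟨b, hb, hle⟩ := ih (B.erase c) (by rw [hsd, Finset.card_erase_of_mem hc, hn]; simp)
      (by simp [hkB])
      (fun x hx => Finset.mem_erase.mpr ⟨by
        rintro rfl; exact hc'.2 (Finset.mem_of_mem_erase hx), hAB hx⟩)
      (fun b hb => hA b (by rw [hsd] at hb; exact Finset.mem_of_mem_erase hb))
    rw [hsd, Finset.mem_erase] at hb
    have hb' := Finset.mem_sdiff.mp hb.2
    have h1 := hlt b hb.2
    have h2 := hlt c hc
    have h3 := hmax b hb.2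
    rcases hf.triple_erase_erase hc'.1 hb'.1 hkB hb.1.symm with h | h <;> linarith

/-- Moves `B` towards `A` by taking in some `u ∈ A \ B` other than `k`, either for free or against
the best good `c ∈ B \ A`. The exchange found at the new bundle descends to `B` by a triple or a
four-point inequality. Once no such `u` is left, `exchange_superset` applies. -/
theorem exchange {A : Bundle K} {k : Fin K} (hkA : k ∈ A) (n : ℕ) :
    ∀ B : Bundle K, (A \ B).card = n → k ∉ B → f (A.erase k) ≤ f A →
      (∀ b ∈ B \ A, f (insert b (A.erase k)) ≤ f A) →
      f (insert k B) < f B → ∃ b ∈ B \ A, f B ≤ f (insert k (B.erase b)) := by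
  induction n with
  | zero =>
    intro B hn hkB
    exact absurd (Finset.mem_sdiff.mpr ⟨hkA, hkB⟩) (by simp [Finset.card_eq_zero.mp hn])
  | succ n ih =>
    intro B hn hkB h0 hA hadd
    by_cases hex : ∃ u ∈ A \ B, u ≠ k
    · obtain ⟨u, hu, huk⟩ := hex
      have hu' := Finset.mem_sdiff.mp hu
      have hku : ∀ C : Bundle K, k ∉ C → k ∉ insert u C := fun C hC => by
        simp [hC, huk.symm]
      by_contra! hlt
      -- If no removal improves on `B + u`, induct on `B + u`; otherwise on `B - c + u` with `c` the
      -- best removal. This choice makes the alternatives of the local inequalities contradictory.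
      by_cases hnull : ∀ b ∈ B \ A, f (insert u (B.erase b)) ≤ f (insert u B)
      · have hsd : insert u B \ A = B \ A := by
          ext x; simp only [Finset.mem_sdiff, Finset.mem_insert]
          have : x = u → x ∈ A := by rintro rfl; exact hu'.1
          tauto
        have hsd' : A \ insert u B = (A \ B).erase u := by
          ext x; simp only [Finset.mem_sdiff, Finset.mem_insert, Finset.mem_erase]; tauto
        have hp := hf.pair_add hu'.2 hkB huk
        obtain ⟨b, hb, hle⟩ := ih (insert u B)
          (by rw [hsd', Finset.card_erase_of_mem hu, hn]; simp) (hku B hkB) h0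
          (by rwa [hsd]) (by linarith)
        rw [hsd] at hb
        have hb' := Finset.mem_sdiff.mp hb
        rw [Finset.erase_insert_of_ne (by rintro rfl; exact hu'.2 hb'.1)] at hle
        have h1 := hlt b hb
        have h2 := hnull b hb
        rcases hf.triple_add_erase hb'.1 hu'.2 hkB huk with h | h <;> linarith
      · push Not at hnull
        obtain ⟨d, hd, hdlt⟩ := hnull
        obtain ⟨c, hc, hmax⟩ := Finset.exists_max_image (B \ A)
          (fun b => f (insert u (B.erase b))) ⟨d, hd⟩
        have hc' := Finset.mem_sdiff.mp hc
        have hcu : f (insert u B) < f (insert u (B.erase c)) := hdlt.trans_le (hmax d hd)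
        have hsd : insert u (B.erase c) \ A = (B \ A).erase c := by
          ext x; simp only [Finset.mem_sdiff, Finset.mem_insert, Finset.mem_erase]
          have : x = u → x ∈ A := by rintro rfl; exact hu'.1
          tauto
        have hsd' : A \ insert u (B.erase c) = (A \ B).erase u := by
          ext x; simp only [Finset.mem_sdiff, Finset.mem_insert, Finset.mem_erase]
          have : x = c → x ∉ A := by rintro rfl; exact hc'.2
          tauto
        have h2 := hlt c hc
        obtain ⟨b, hb, hle⟩ := ih (insert u (B.erase c))
          (by rw [hsd', Finset.card_erase_of_mem hu, hn]; simp) (hku _ (by simp [hkB])) h0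
          (fun b hb => hA b (by rw [hsd] at hb; exact Finset.mem_of_mem_erase hb))
          (by rcases hf.triple_add_erase hc'.1 hu'.2 hkB huk with h | h <;> linarith)
        rw [hsd, Finset.mem_erase] at hb
        have hb' := Finset.mem_sdiff.mp hb.2
        rw [Finset.erase_insert_of_ne (by rintro rfl; exact hu'.2 hb'.1)] at hle
        have h1 := hlt b hb.2
        have h3 := hmax b hb.2
        rcases hf.four_erase_erase hc'.1 hb'.1 hu'.2 hkB huk hb.1.symm with h | h <;> linarith
    · push Not at hex
      have hAB : A.erase k ⊆ B := by
        intro x hx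
        by_contra hxB
        exact (Finset.mem_erase.mp hx).1
          (hex x (Finset.mem_sdiff.mpr ⟨Finset.mem_of_mem_erase hx, hxB⟩))
      rcases Nat.eq_zero_or_pos (B \ A).card with hz | hpos
      · have hBA : B = A.erase k := by
          refine Finset.Subset.antisymm (fun x hx => Finset.mem_erase.mpr ⟨?_, ?_⟩) hAB
          · rintro rfl; exact hkB hx
          · exact (Finset.sdiff_eq_empty_iff_subset.mp (Finset.card_eq_zero.mp hz)) hx
        rw [hBA, Finset.insert_erase hkA] at hadd
        linarith
      · exact hf.exchange_superset hkA _ B (Nat.sub_add_cancel hpos).symm hkB hAB hA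

end LocalExchange

/-! ### The substitute property from local exchange. -/

section Payoff

variable {K : ℕ} {v : Bundle K → ℝ}

theorem LocalExchange.payoff (hv : LocalExchange v) (p : Fin K → ℝ) :
    LocalExchange (payoff v p) where
  pair A i j hi hj hij := by
    have := hv.pair A i j hi hj hij
    simp only [SubstituteGen.payoff]
    rw [Finset.sum_insert (by simp [hi, hij]), Finset.sum_insert hi, Finset.sum_insert hj]
    linarith
  triple A i j k hi hj hk hij hik hjk := by
    have := hv.triple A i j k hi hj hk hij hik hjk
    simp only [SubstituteGen.payoff]
    have two : ∀ a b : Fin K, a ∉ A → b ∉ A → a ≠ b →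
        ∑ x ∈ insert a (insert b A), p x = p a + (p b + ∑ x ∈ A, p x) := fun a b ha hb hab => by
      rw [Finset.sum_insert (by simp [ha, hab]), Finset.sum_insert hb]
    rw [two i j hi hj hij, two i k hi hk hik, two j k hj hk hjk, Finset.sum_insert hi,
      Finset.sum_insert hj, Finset.sum_insert hk]
    rcases this with h | h
    · left; linarith
    · right; linarith

theorem payoff_update_of_notMem (p : Fin K → ℝ) {k : Fin K} (x : ℝ) {A : Bundle K} (hk : k ∉ A) :
    payoff v (Function.update p k x) A = payoff v p A := by
  simp only [payoff]
  rw [Finset.sum_update_of_notMem hk]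

theorem payoff_update_of_mem (p : Fin K → ℝ) {k : Fin K} (x : ℝ) {A : Bundle K} (hk : k ∈ A) :
    payoff v (Function.update p k x) A = payoff v p A + p k - x := by
  simp only [payoff]
  rw [Finset.sum_update_of_mem hk, ← Finset.add_sum_erase A p hk, Finset.sdiff_singleton_eq_erase]
  ring

theorem demand_nonempty (v : Bundle K → ℝ) (p : Fin K → ℝ) : (demand v p).Nonempty := by
  obtain ⟨A, -, hA⟩ := Finset.exists_max_image Finset.univ (payoff v p) Finset.univ_nonempty
  exact ⟨A, fun B => hA B (Finset.mem_univ B)⟩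

/-- The substitute property for the rise of a single price. -/
theorem LocalExchange.demand_update (hv : LocalExchange v) {p : Fin K → ℝ} {k : Fin K} {x : ℝ}
    (hx : p k ≤ x) {A : Bundle K} (hA : A ∈ demand v p) :
    ∃ A' ∈ demand v (Function.update p k x), A.erase k ⊆ A' := by
  by_cases hkA : k ∈ A
  swap
  · refine ⟨A, fun B => ?_, Finset.erase_subset _ _⟩
    rw [payoff_update_of_notMem p x hkA]
    by_cases hkB : k ∈ B
    · rw [payoff_update_of_mem p x hkB]; linarith [hA B]
    · rw [payoff_update_of_notMem p x hkB]; exact hA B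
  by_contra! hno
  obtain ⟨B, hB⟩ := demand_nonempty v (Function.update p k x)
  -- A bundle containing `A - k` and tied with `B` would itself be demanded, against `hno`.
  have key : ∀ C : Bundle K, A.erase k ⊆ C →
      SubstituteGen.payoff v (Function.update p k x) C <
        SubstituteGen.payoff v (Function.update p k x) B := by
    intro C hC
    refine lt_of_le_of_ne (hB C) fun heq => hno C (fun D => ?_) hC
    rw [heq]; exact hB D
  have hkB : k ∉ B := by
    intro hkB
    have h1 := key A (Finset.erase_subset _ _)
    rw [payoff_update_of_mem p x hkA, payoff_update_of_mem p x hkB] at h1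
    linarith [hA B]
  -- Lower the price of `k` until `A` is as good as the best set obtained by giving `k` up.
  let T : Finset (Bundle K) :=
    insert (A.erase k) ((B \ A).image fun b => insert b (A.erase k))
  have hTk : ∀ C ∈ T, k ∉ C := by
    intro C hC
    simp only [T, Finset.mem_insert, Finset.mem_image, Finset.mem_sdiff] at hC
    rcases hC with rfl | ⟨b, ⟨hb, -⟩, rfl⟩
    · simp
    · simp; rintro rfl; exact hkB hb
  have hTA : ∀ C ∈ T, A.erase k ⊆ C := by
    intro C hC
    simp only [T, Finset.mem_insert, Finset.mem_image, Finset.mem_sdiff] at hC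
    rcases hC with rfl | ⟨b, ⟨hb, -⟩, rfl⟩
    · exact subset_rfl
    · exact Finset.subset_insert _ _
  obtain ⟨M, hM, hmax⟩ := Finset.exists_max_image T (SubstituteGen.payoff v p)
    ⟨_, Finset.mem_insert_self _ _⟩
  have hMB : SubstituteGen.payoff v p M < SubstituteGen.payoff v p B := by
    have := key M (hTA M hM)
    rwa [payoff_update_of_notMem p x (hTk M hM), payoff_update_of_notMem p x hkB] at this
  set y : ℝ := SubstituteGen.payoff v p A + p k - SubstituteGen.payoff v p M with hy
  have hAy : SubstituteGen.payoff v (Function.update p k y) A = SubstituteGen.payoff v p M := by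
    rw [payoff_update_of_mem p y hkA, hy]; ring
  have hle : ∀ C ∈ T, SubstituteGen.payoff v (Function.update p k y) C ≤
      SubstituteGen.payoff v (Function.update p k y) A := by
    intro C hC
    rw [hAy, payoff_update_of_notMem p y (hTk C hC)]
    exact hmax C hC
  -- At price `y` a bundle with `k` earns at most what `A` earns, since `A` was optimal at `p`; that
  -- is the payoff of `M`, strictly below that of `B`.
  have hlt : ∀ C : Bundle K, k ∈ C → SubstituteGen.payoff v (Function.update p k y) C <
      SubstituteGen.payoff v (Function.update p k y) B := by
    intro C hC
    rw [payoff_update_of_mem p y hC, payoff_update_of_notMem p y hkB, hy]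
    linarith [hA C]
  obtain ⟨b, hb, hb'⟩ := (hv.payoff (Function.update p k y)).exchange hkA _ B rfl hkB
    (hle _ (Finset.mem_insert_self _ _))
    (fun b hb => hle _ (Finset.mem_insert_of_mem (Finset.mem_image_of_mem _ hb)))
    (hlt _ (Finset.mem_insert_self _ _))
  exact absurd (hlt _ (Finset.mem_insert_self k (B.erase b))) (not_lt.mpr hb')

/-- The prices are raised one good at a time. Each rise can cost only the good whose price really
changes, so goods with unchanged price survive; `T` collects the goods already treated. -/
theorem LocalExchange.isSubstituteValuation (hv : LocalExchange v) (h0 : v ∅ = 0) :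
    IsSubstituteValuation v := by
  refine ⟨h0, fun p q _ hpq A hA => ?_⟩
  have key : ∀ T : Finset (Fin K), ∃ A' ∈ demand v (fun k => if k ∈ T then q k else p k),
      ∀ k ∈ A, p k = q k → k ∈ A' := by
    intro T
    induction T using Finset.induction_on with
    | empty => exact ⟨A, by simpa using hA, fun k hk _ => hk⟩
    | insert a T ha ih =>
      obtain ⟨A₁, hA₁, hsub⟩ := ih
      have hup : (fun k => if k ∈ insert a T then q k else p k) =
          Function.update (fun k => if k ∈ T then q k else p k) a (q a) := by
        funext k
        by_cases hk : k = a
        · subst hk; simp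
        · simp [hk]
      by_cases hpa : p a = q a
      · refine ⟨A₁, ?_, hsub⟩
        rw [hup, Function.update_eq_self_iff.mpr (by simp [ha, hpa])]
        exact hA₁
      · obtain ⟨A₂, hA₂, h₂⟩ := hv.demand_update (k := a) (x := q a) (by simp [ha, hpq a]) hA₁
        refine ⟨A₂, by rw [hup]; exact hA₂, fun k hk hkq => h₂ (Finset.mem_erase.mpr ⟨?_, hsub k hk hkq⟩)⟩
        rintro rfl; exact hpa hkq
  obtain ⟨A', hA', h⟩ := key Finset.univ
  exact ⟨A', by simpa using hA', h⟩

end Payoff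

/-! ### Supermodularity from pairs. -/

/-- Supermodularity follows from its instances on pairs of goods. -/
theorem isSupermodular_of_pair {K : ℕ} {θ : Bundle K → ℝ}
    (h : ∀ (A : Bundle K) (i j : Fin K), i ∉ A → j ∉ A → i ≠ j →
      θ (insert i A) + θ (insert j A) ≤ θ (insert i (insert j A)) + θ A) :
    IsSupermodular θ := by
  -- The marginal of a single good grows as the base is enlarged good by good; `h2` then telescopes
  -- over the added goods.
  have h1 : ∀ (D C : Bundle K) (i : Fin K), i ∉ C → i ∉ D →
      θ (insert i C) + θ (D ∪ C) ≤ θ (insert i (D ∪ C)) + θ C := by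
    intro D C i hiC
    induction D using Finset.induction_on with
    | empty => intro _; simp
    | insert d D hd ih =>
      intro hiD
      simp only [Finset.mem_insert, not_or] at hiD
      rw [Finset.insert_union]
      by_cases hdC : d ∈ D ∪ C
      · rw [Finset.insert_eq_of_mem hdC]; exact ih hiD.2
      · have := h (D ∪ C) i d (by simp [hiC, hiD.2]) hdC hiD.1
        linarith [ih hiD.2]
  have h2 : ∀ (D C B : Bundle K), C ⊆ B → Disjoint D B →
      θ (D ∪ C) + θ B ≤ θ (D ∪ B) + θ C := by
    intro D C B hCB
    induction D using Finset.induction_on with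
    | empty => intro _; simp [add_comm]
    | insert d D hd ih =>
      intro hdis
      rw [Finset.disjoint_insert_left] at hdis
      have := h1 (D ∪ B) (D ∪ C) d (by simp [hd, Finset.notMem_mono hCB hdis.1]) (by simp [hd, hdis.1])
      rw [Finset.union_eq_left.mpr (Finset.union_subset_union subset_rfl hCB)] at this
      rw [Finset.insert_union, Finset.insert_union]
      linarith [ih hdis.2]
  intro A B
  have := h2 (A \ B) (A ∩ B) B Finset.inter_subset_right Finset.sdiff_disjoint
  rwa [Finset.sdiff_union_inter, Finset.sdiff_union_self_eq_union] at this

/-! ### The invariant of a phase. -/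

variable {K : ℕ}

/-- The inequality enforced by a statement of the first part of a phase. -/
def PairIneq (θ : Bundle K → ℤ) (A : Bundle K) (i j : Fin K) : Prop :=
  θ (insert i A) + θ (insert j A) - θ A ≤ θ (insert i (insert j A))

/-- The inequality enforced by a statement of the second part of a phase. -/
def TripleIneq (θ : Bundle K → ℤ) (A : Bundle K) (i j k : Fin K) : Prop :=
  min (θ (insert i (insert k A)) + θ (insert j A)) (θ (insert j (insert k A)) + θ (insert i A))
    - θ (insert k A) ≤ θ (insert i (insert j A))

theorem mem_pairTasks {L : ℕ} {A : Bundle K} {i j : Fin K} :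
    (A, i, j) ∈ pairTasks K L ↔ A.card + 2 = L ∧ i ∉ A ∧ j ∉ A ∧ i ≠ j := by
  simp [pairTasks]

theorem mem_tripleTasks {L : ℕ} {A : Bundle K} {i j k : Fin K} :
    (A, i, j, k) ∈ tripleTasks K L ↔
      A.card + 2 = L ∧ i ∉ A ∧ j ∉ A ∧ k ∉ A ∧ i ≠ j ∧ i ≠ k ∧ j ≠ k := by
  simp [tripleTasks]

theorem card_insert_insert {A : Bundle K} {i j : Fin K} (hi : i ∉ A) (hj : j ∉ A) (hij : i ≠ j) :
    (insert i (insert j A)).card = A.card + 2 := by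
  rw [Finset.card_insert_of_notMem (by simp [hi, hij]), Finset.card_insert_of_notMem hj]

/-- Raise the value at `B` to at least `x`. -/
def raise (θ : Bundle K → ℤ) (B : Bundle K) (x : ℤ) : Bundle K → ℤ :=
  Function.update θ B (max (θ B) x)

theorem le_raise (θ : Bundle K → ℤ) (B : Bundle K) (x : ℤ) (C : Bundle K) :
    θ C ≤ raise θ B x C := by
  unfold raise
  by_cases h : C = B
  · subst h; simp
  · simp [h]

theorem le_raise_self (θ : Bundle K → ℤ) (B : Bundle K) (x : ℤ) : x ≤ raise θ B x B := by
  simp [raise]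

theorem raise_of_card_ne {θ : Bundle K → ℤ} {B : Bundle K} {x : ℤ} {C : Bundle K}
    (h : C.card ≠ B.card) : raise θ B x C = θ C := by
  have : C ≠ B := by rintro rfl; exact h rfl
  simp [raise, this]

theorem raise_le {θ U : Bundle K → ℤ} {B : Bundle K} {x : ℤ} (h : ∀ C, θ C ≤ U C)
    (hx : x ≤ U B) (C : Bundle K) : raise θ B x C ≤ U C := by
  unfold raise
  by_cases hC : C = B
  · subst hC; simp [h, hx]
  · simp [hC, h]

/-- Within phase `L` the function `θ` is an interaction function at or above `θo`, still equal to
`θo` above level `L`, already correct below level `L`, and at each level at most every feasible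
function with the same lower levels. -/
structure PhaseInv (θo : Bundle K → ℤ) (L : ℕ) (θ : Bundle K → ℤ) : Prop where
  small : ∀ A : Bundle K, A.card ≤ 1 → θ A = 0
  ge : ∀ A, θo A ≤ θ A
  untouched : ∀ A : Bundle K, L < A.card → θ A = θo A
  pair : ∀ (A : Bundle K) (i j : Fin K), A.card + 2 < L → i ∉ A → j ∉ A → i ≠ j → PairIneq θ A i j
  triple : ∀ (A : Bundle K) (i j k : Fin K), A.card + 2 < L → i ∉ A → j ∉ A → k ∉ A →
    i ≠ j → i ≠ k → j ≠ k → TripleIneq θ A i j k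
  minimal : ∀ θ' ∈ Feasible (toReal θo), ∀ n : ℕ,
    (∀ A : Bundle K, A.card < n → toReal θ A = θ' A) →
      ∀ A : Bundle K, A.card = n → toReal θ A ≤ θ' A

/-- A pair inequality survives raising values from the level of its largest bundle on. -/
theorem PairIneq.congr {θ η : Bundle K → ℤ} {A : Bundle K} {i j : Fin K} (hi : i ∉ A) (hj : j ∉ A)
    (h : PairIneq θ A i j)
    (hlow : ∀ C : Bundle K, C.card < A.card + 2 → η C = θ C) (hle : ∀ C, θ C ≤ η C) :
    PairIneq η A i j := by
  unfold PairIneq at *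
  rw [hlow (insert i A) (by rw [Finset.card_insert_of_notMem hi]; omega),
    hlow (insert j A) (by rw [Finset.card_insert_of_notMem hj]; omega), hlow A (by omega)]
  exact h.trans (hle _)

/-- Only bundles of size `L` are affected, so the finished levels stay correct and larger bundles
keep their values from `θo`. Minimality at level `L` needs just that the new value be forced on each
feasible function that agrees below `L` and dominates at `L`. -/
theorem PhaseInv.raise {θo θ : Bundle K → ℤ} {L : ℕ} (h : PhaseInv θo L θ) (hL : 2 ≤ L)
    {B : Bundle K} (hB : B.card = L) {x : ℤ}
    (hx : ∀ θ' ∈ Feasible (toReal θo), (∀ A : Bundle K, A.card < L → toReal θ A = θ' A) →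
      (∀ A : Bundle K, A.card = L → toReal θ A ≤ θ' A) → (x : ℝ) ≤ θ' B) :
    PhaseInv θo L (raise θ B x) where
  small A hA := by rw [raise_of_card_ne (by omega)]; exact h.small A hA
  ge A := (h.ge A).trans (le_raise _ _ _ _)
  untouched A hA := by rw [raise_of_card_ne (by omega)]; exact h.untouched A hA
  pair A i j hA hi hj hij :=
    (h.pair A i j hA hi hj hij).congr hi hj
      (fun C hC => raise_of_card_ne (by omega)) (le_raise θ B x)
  triple A i j k hA hi hj hk hij hik hjk := by
    have := h.triple A i j k hA hi hj hk hij hik hjk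
    unfold TripleIneq at *
    have h1 : ∀ C : Bundle K, C.card < L → SubstituteGen.raise θ B x C = θ C := fun C hC =>
      raise_of_card_ne (by omega)
    rw [h1, h1, h1, h1, h1, h1]
    · exact this
    all_goals
      first
      | rw [card_insert_insert] <;> omega
      | rw [Finset.card_insert_of_notMem (by assumption)]; omega
  minimal θ' hθ' n hn A hA := by
    rcases lt_trichotomy n L with hnL | rfl | hnL
    · have h1 : ∀ C : Bundle K, C.card ≤ n → toReal (SubstituteGen.raise θ B x) C = toReal θ C :=
        fun C hC => by simp only [toReal]; rw [raise_of_card_ne (by omega)]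
      rw [h1 A hA.le]
      exact h.minimal θ' hθ' n (fun C hC => by rw [← h1 C hC.le]; exact hn C hC) A hA
    · have hlow : ∀ C : Bundle K, C.card < n → toReal θ C = θ' C := fun C hC => by
        rw [← hn C hC]; simp only [toReal]; rw [raise_of_card_ne (by omega)]
      have hmin := h.minimal θ' hθ' n hlow
      have hx' := hx θ' hθ' hlow hmin
      simp only [toReal, SubstituteGen.raise]
      by_cases hAB : A = B
      · subst hAB
        have := hmin A hA
        simp only [toReal] at this
        simp [this, hx']
      · rw [Function.update_of_ne hAB]
        exact hmin A hA
    · simp only [toReal]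
      rw [raise_of_card_ne (by omega), h.untouched A (by omega)]
      exact hθ'.2.2.2 A

theorem PhaseInv.pairUpdate {θo θ : Bundle K → ℤ} {L : ℕ} (h : PhaseInv θo L θ)
    {t : Bundle K × Fin K × Fin K} (ht : t ∈ pairTasks K L) :
    PhaseInv θo L (pairUpdate θ t) := by
  obtain ⟨A, i, j⟩ := t
  obtain ⟨hA, hi, hj, hij⟩ := mem_pairTasks.mp ht
  refine h.raise (by omega) ((card_insert_insert hi hj hij).trans hA) fun θ' hθ' hlow _ => ?_
  have hs := hθ'.2.1 (insert i A) (insert j A)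
  have e1 : insert i A ∪ insert j A = insert i (insert j A) := by
    ext x; simp only [Finset.mem_union, Finset.mem_insert]; tauto
  have e2 : insert i A ∩ insert j A = A := by
    ext x
    simp only [Finset.mem_inter, Finset.mem_insert]
    have : x = i → x ≠ j := by rintro rfl; exact hij
    tauto
  rw [e1, e2, ← hlow (insert i A) (by rw [Finset.card_insert_of_notMem hi]; omega),
    ← hlow (insert j A) (by rw [Finset.card_insert_of_notMem hj]; omega),
    ← hlow A (by omega)] at hs
  simp only [toReal] at hs
  push_cast
  linarith

theorem PhaseInv.tripleUpdate {θo θ : Bundle K → ℤ} {L : ℕ} (h : PhaseInv θo L θ)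
    {t : Bundle K × Fin K × Fin K × Fin K} (ht : t ∈ tripleTasks K L) :
    PhaseInv θo L (tripleUpdate θ t) := by
  obtain ⟨A, i, j, k⟩ := t
  obtain ⟨hA, hi, hj, hk, hij, hik, hjk⟩ := mem_tripleTasks.mp ht
  refine h.raise (by omega) ((card_insert_insert hi hj hij).trans hA) fun θ' hθ' hlow hle => ?_
  -- `S3` is imposed only up to level `K - 1`; the goods `i, j, k` outside `A` ensure that `L` is in
  -- range.
  have hK : L + 1 ≤ K := by
    have h1 : (insert k (insert i (insert j A))).card ≤ K := by
      simpa using Finset.card_le_univ (insert k (insert i (insert j A)))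
    rw [Finset.card_insert_of_notMem (by simp [hk, hik.symm, hjk.symm]),
      card_insert_insert hi hj hij] at h1
    omega
  have hs := (hθ'.2.2.1 L (by omega) hK A i j k hA hi hj hk hij hik hjk).1
  have h1 := hle (insert i (insert k A)) ((card_insert_insert hi hk hik).trans hA)
  have h2 := hle (insert j (insert k A)) ((card_insert_insert hj hk hjk).trans hA)
  rw [← hlow (insert i A) (by rw [Finset.card_insert_of_notMem hi]; omega),
    ← hlow (insert j A) (by rw [Finset.card_insert_of_notMem hj]; omega),
    ← hlow (insert k A) (by rw [Finset.card_insert_of_notMem hk]; omega)] at hs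
  simp only [toReal] at hs h1 h2
  push_cast
  have := min_le_min (add_le_add_left h1 (θ (insert j A) : ℝ))
    (add_le_add_left h2 (θ (insert i A) : ℝ))
  linarith

/-! ### The invariant along executions. -/

/-- The invariant of the executions of the algorithm. -/
def Inv (θo : Bundle K → ℤ) (μo : Fin K → ℤ) : Config K → Prop
  | .part1 L todo θ => L ≤ K ∧ PhaseInv θo L θ ∧ todo ⊆ pairTasks K L ∧
      ∀ A i j, (A, i, j) ∈ pairTasks K L → (A, i, j) ∉ todo → PairIneq θ A i j
  | .part2 L todo changed θ => L ≤ K ∧ PhaseInv θo L θ ∧ todo ⊆ tripleTasks K L ∧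
      (∀ A i j, (A, i, j) ∈ pairTasks K L → PairIneq θ A i j) ∧
      (changed = false → ∀ A i j k, (A, i, j, k) ∈ tripleTasks K L → (A, i, j, k) ∉ todo →
        TripleIneq θ A i j k)
  | .part3 todo θ μ => (∃ L, K < L ∧ PhaseInv θo L θ) ∧
      ∀ k, k ∉ todo → μ k = max (μo k) (maxMarginal θ k)
  | .halted θ μ => (∃ L, K < L ∧ PhaseInv θo L θ) ∧ ∀ k, μ k = max (μo k) (maxMarginal θ k)

theorem inv_enterPhase {θo θ : Bundle K → ℤ} (μo : Fin K → ℤ) {L : ℕ} (h : PhaseInv θo L θ) :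
    Inv θo μo (enterPhase μo L θ) := by
  unfold enterPhase
  split_ifs with hL
  · exact ⟨hL, h, subset_rfl, fun _ _ _ h1 h2 => absurd h1 h2⟩
  · exact ⟨⟨L, by omega, h⟩, by simp⟩

theorem phaseInv_start {θo : Bundle K → ℤ} (hθo : IsInteractionFunction (toReal θo)) :
    PhaseInv θo 2 θo where
  small A hA := by simpa [toReal] using hθo A hA
  ge _ := le_rfl
  untouched _ _ := rfl
  pair _ _ _ h := by omega
  triple _ _ _ _ h := by omega
  minimal _ hθ' _ _ A _ := hθ'.2.2.2 A

theorem PhaseInv.succ {θo θ : Bundle K → ℤ} {L : ℕ} (h : PhaseInv θo L θ)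
    (hpair : ∀ A i j, (A, i, j) ∈ pairTasks K L → PairIneq θ A i j)
    (htriple : ∀ A i j k, (A, i, j, k) ∈ tripleTasks K L → TripleIneq θ A i j k) :
    PhaseInv θo (L + 1) θ where
  small := h.small
  ge := h.ge
  untouched A hA := h.untouched A (by omega)
  pair A i j hA hi hj hij := by
    rcases (show A.card + 2 < L ∨ A.card + 2 = L by omega) with h1 | h1
    · exact h.pair A i j h1 hi hj hij
    · exact hpair A i j (mem_pairTasks.mpr ⟨h1, hi, hj, hij⟩)
  triple A i j k hA hi hj hk hij hik hjk := by
    rcases (show A.card + 2 < L ∨ A.card + 2 = L by omega) with h1 | h1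
    · exact h.triple A i j k h1 hi hj hk hij hik hjk
    · exact htriple A i j k (mem_tripleTasks.mpr ⟨h1, hi, hj, hk, hij, hik, hjk⟩)
  minimal := h.minimal

theorem tripleIneq_of_tripleUpdate_eq {θ : Bundle K → ℤ} {A : Bundle K} {i j k : Fin K}
    (h : tripleUpdate θ (A, i, j, k) = θ) : TripleIneq θ A i j k := by
  unfold TripleIneq
  conv_rhs => rw [← h]
  exact le_raise_self _ _ _

theorem Inv.step {θo : Bundle K → ℤ} {μo : Fin K → ℤ} {c c' : Config K} (hc : Inv θo μo c)
    (hs : Step μo c c') : Inv θo μo c' := by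
  cases hs with
  | pair L todo θ t ht =>
    obtain ⟨hL, h, hsub, hdone⟩ := hc
    refine ⟨hL, h.pairUpdate (hsub ht), (Finset.erase_subset _ _).trans hsub, ?_⟩
    intro A i j hm hnot
    obtain ⟨B, a, b⟩ := t
    obtain ⟨hA, hi, hj, hij⟩ := mem_pairTasks.mp hm
    obtain ⟨hB, ha, hb, hab⟩ := mem_pairTasks.mp (hsub ht)
    have hcard := card_insert_insert ha hb hab
    by_cases heq : (A, i, j) = (B, a, b)
    · simp only [Prod.mk.injEq] at heq
      obtain ⟨rfl, rfl, rfl⟩ := heq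
      have low : ∀ C : Bundle K, C.card < L → pairUpdate θ (A, i, j) C = θ C := fun C hC =>
        raise_of_card_ne (by omega)
      unfold PairIneq
      rw [low (insert i A) (by rw [Finset.card_insert_of_notMem hi]; omega),
        low (insert j A) (by rw [Finset.card_insert_of_notMem hj]; omega), low A (by omega)]
      exact le_raise_self _ _ _
    · exact (hdone A i j hm fun hmem => hnot (Finset.mem_erase.mpr ⟨heq, hmem⟩)).congr hi hj
        (fun C hC => raise_of_card_ne (by omega)) (le_raise _ _ _)
  | pairsDone L θ =>
    obtain ⟨hL, h, hsub, hdone⟩ := hc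
    exact ⟨hL, h, subset_rfl, fun A i j hm => hdone A i j hm (by simp),
      fun _ _ _ _ _ h1 h2 => absurd h1 h2⟩
  | triple L todo changed θ t ht =>
    obtain ⟨hL, h, hsub, hpair, hdone⟩ := hc
    refine ⟨hL, h.tripleUpdate (hsub ht), (Finset.erase_subset _ _).trans hsub, ?_, ?_⟩
    · intro A i j hm
      obtain ⟨B, a, b, d⟩ := t
      obtain ⟨hA, hi, hj, hij⟩ := mem_pairTasks.mp hm
      obtain ⟨hB, ha, hb, -, hab, -⟩ := mem_tripleTasks.mp (hsub ht)
      have hcard := card_insert_insert ha hb hab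
      exact (hpair A i j hm).congr hi hj (fun C hC => raise_of_card_ne (by omega)) (le_raise _ _ _)
    -- Unlike pair inequalities, triple inequalities can be broken by later raises at the same
    -- level. They persist here because an unset flag means that `θ` has not moved.
    · intro hch A i j k hm hnot
      simp only [Bool.or_eq_false_iff, decide_eq_false_iff_not, not_not] at hch
      by_cases heq : (A, i, j, k) = t
      · rw [hch.2]; exact tripleIneq_of_tripleUpdate_eq (heq ▸ hch.2)
      · rw [hch.2]
        exact hdone hch.1 A i j k hm fun hmem => hnot (Finset.mem_erase.mpr ⟨heq, hmem⟩)
  | again L θ =>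
    obtain ⟨hL, h, hsub, hpair, hdone⟩ := hc
    exact ⟨hL, h, subset_rfl, hpair, fun _ _ _ _ _ h1 h2 => absurd h1 h2⟩
  | phaseDone L θ =>
    obtain ⟨hL, h, hsub, hpair, hdone⟩ := hc
    exact inv_enterPhase μo (h.succ hpair fun A i j k hm => hdone rfl A i j k hm (by simp))
  | setMu todo θ μ k hk =>
    obtain ⟨h, hdone⟩ := hc
    refine ⟨h, fun l hl => ?_⟩
    by_cases hlk : l = k
    · subst hlk; simp
    · rw [Function.update_of_ne hlk]
      exact hdone l fun hmem => hl (Finset.mem_erase.mpr ⟨hlk, hmem⟩)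
  | halt θ μ =>
    obtain ⟨h, hdone⟩ := hc
    exact ⟨h, fun k => hdone k (by simp)⟩

theorem inv_of_reachable {θo : Bundle K → ℤ} {μo : Fin K → ℤ}
    (hθo : IsInteractionFunction (toReal θo)) {c : Config K} (hc : Reachable θo μo c) :
    Inv θo μo c := by
  induction hc with
  | refl => exact inv_enterPhase μo (phaseInv_start hθo)
  | tail _ hs ih => exact ih.step hs

/-! ### Termination -/

theorem four_point_int {θ : Bundle K → ℤ} {A : Bundle K}
    (h : ∀ i j k : Fin K, i ∉ A → j ∉ A → k ∉ A → i ≠ j → i ≠ k → j ≠ k → TripleIneq θ A i j k)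
    {i j k l : Fin K} (hi : i ∉ A) (hj : j ∉ A) (hk : k ∉ A) (hl : l ∉ A)
    (hij : i ≠ j) (hik : i ≠ k) (hil : i ≠ l) (hjk : j ≠ k) (hjl : j ≠ l) (hkl : k ≠ l) :
    θ (insert i (insert k A)) + θ (insert j (insert l A)) ≤
        θ (insert i (insert j A)) + θ (insert k (insert l A)) ∨
      θ (insert i (insert l A)) + θ (insert j (insert k A)) ≤
        θ (insert i (insert j A)) + θ (insert k (insert l A)) := by
  have := four_point (fun B => ((-θ B : ℤ) : ℝ)) A (fun i j k hi hj hk hij hik hjk => by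
    have := h i j k hi hj hk hij hik hjk
    unfold TripleIneq at this
    norm_cast
    omega) hi hj hk hl hij hik hil hjk hjl hkl
  norm_cast at this
  omega

/-- The values that a phase can assign to the bundles of size `L` are bounded: a sufficiently high
translate of `B ↦ min_{b ∈ B} θ(B - b)` already satisfies all inequalities of the phase. -/
theorem PhaseInv.exists_bound {θo θ : Bundle K → ℤ} {L : ℕ} (h : PhaseInv θo L θ) :
    ∃ U : Bundle K → ℤ, (∀ B, θ B ≤ U B) ∧ (∀ B : Bundle K, B.card ≠ L → U B = θ B) ∧
      ∀ A i j k, (A, i, j, k) ∈ tripleTasks K L → TripleIneq U A i j k := by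
  have hm : ∀ B : Bundle K, ∃ x : ℤ, B.Nonempty →
      (∀ b ∈ B, x ≤ θ (B.erase b)) ∧ ∃ b ∈ B, x = θ (B.erase b) := by
    intro B
    by_cases hB : B.Nonempty
    · obtain ⟨b, hb, hmin⟩ := Finset.exists_min_image B (fun b => θ (B.erase b)) hB
      exact ⟨_, fun _ => ⟨hmin, b, hb, rfl⟩⟩
    · exact ⟨0, fun h => absurd h hB⟩
  choose m hm using hm
  -- The translate `c` is the least constant for which `c + m` dominates `θ` on all bundles.
  obtain ⟨B₀, -, hc⟩ := Finset.exists_max_image Finset.univ (fun B : Bundle K => θ B - m B)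
    Finset.univ_nonempty
  set c := θ B₀ - m B₀
  refine ⟨fun B => if B.card = L then c + m B else θ B, fun B => ?_, fun B hB => by simp [hB], ?_⟩
  · have := hc B (Finset.mem_univ B)
    dsimp only
    split_ifs <;> omega
  intro A i j k ht
  obtain ⟨hA, hi, hj, hk, hij, hik, hjk⟩ := mem_tripleTasks.mp ht
  have one : ∀ a : Fin K, a ∉ A → (insert a A).card ≠ L := fun a ha => by
    rw [Finset.card_insert_of_notMem ha]; omega
  have two : ∀ a b : Fin K, a ∉ A → b ∉ A → a ≠ b → (insert a (insert b A)).card = L :=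
    fun a b ha hb hab => (card_insert_insert ha hb hab).trans hA
  unfold TripleIneq
  simp only [one i hi, one j hj, one k hk, two i j hi hj hij, two i k hi hk hik,
    two j k hj hk hjk, if_true, if_false]
  obtain ⟨-, b, hb, hmb⟩ := hm (insert i (insert j A)) (Finset.insert_nonempty _ _)
  have mik := (hm (insert i (insert k A)) (Finset.insert_nonempty _ _)).1
  have mjk := (hm (insert j (insert k A)) (Finset.insert_nonempty _ _)).1
  have er : ∀ a b : Fin K, a ∉ A → a ≠ b → (insert a (insert b A)).erase a = insert b A :=
    fun a b ha hab => Finset.erase_insert (by simp [ha, hab])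
  rw [hmb]
  rcases Finset.mem_insert.mp hb with rfl | hb
  · have := mik b (by simp)
    rw [er b k hi hik] at this
    rw [er b j hi hij]
    omega
  rcases Finset.mem_insert.mp hb with rfl | hb
  · have := mjk b (by simp)
    rw [er b k hj hjk] at this
    rw [Finset.insert_comm i b, er b i hj hij.symm]
    omega
  -- When the minimum for `Aij` is attained by removing some `b ∈ A`, the claim is the four-point
  -- inequality for `i, j, k, b` over `A - b`, whose triple inequalities belong to the previous,
  -- finished level.
  · have nb : ∀ a : Fin K, a ∉ A → a ≠ b := by rintro a ha rfl; exact ha hb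
    have hC : insert b (A.erase b) = A := Finset.insert_erase hb
    have hcard : (A.erase b).card + 1 = A.card := Finset.card_erase_add_one hb
    have er' : ∀ x y : Fin K, x ∉ A → y ∉ A →
        (insert x (insert y A)).erase b = insert x (insert y (A.erase b)) := fun x y hx hy => by
      rw [Finset.erase_insert_of_ne (nb x hx), Finset.erase_insert_of_ne (nb y hy)]
    have h1 := mik b (by simp [hb])
    have h2 := mjk b (by simp [hb])
    rw [er' i k hi hk] at h1
    rw [er' j k hj hk] at h2
    rw [er' i j hi hj]
    have := four_point_int (θ := θ) (A := A.erase b)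
      (fun i j k => h.triple (A.erase b) i j k (by omega))
      (i := i) (j := j) (k := k) (l := b) (by simp [hi]) (by simp [hj]) (by simp [hk]) (by simp)
      hij hik (nb i hi) hjk (nb j hj) (nb k hk)
    rw [hC] at this
    omega

/-- The assigned value is monotone in the values of size `L`, so it cannot overshoot a function that
already satisfies the inequality and agrees with `θ` at other sizes. -/
theorem tripleUpdate_le {θ U : Bundle K → ℤ} {L : ℕ} (hle : ∀ B, θ B ≤ U B)
    (heq : ∀ B : Bundle K, B.card ≠ L → U B = θ B)
    (hU : ∀ A i j k, (A, i, j, k) ∈ tripleTasks K L → TripleIneq U A i j k)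
    {t : Bundle K × Fin K × Fin K × Fin K} (ht : t ∈ tripleTasks K L) :
    (∀ B, tripleUpdate θ t B ≤ U B) ∧
      ∀ B : Bundle K, B.card ≠ L → U B = tripleUpdate θ t B := by
  obtain ⟨A, i, j, k⟩ := t
  have hT := hU A i j k ht
  obtain ⟨hA, hi, hj, hk, hij, hik, hjk⟩ := mem_tripleTasks.mp ht
  have hcard := card_insert_insert hi hj hij
  refine ⟨raise_le hle ?_, fun B hB => ?_⟩
  · have one : ∀ a : Fin K, a ∉ A → U (insert a A) = θ (insert a A) := fun a ha =>
      heq _ (by rw [Finset.card_insert_of_notMem ha]; omega)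
    unfold TripleIneq at hT
    rw [one i hi, one j hj, one k hk] at hT
    have h1 := hle (insert i (insert k A))
    have h2 := hle (insert j (insert k A))
    omega
  · rw [heq B hB]
    exact (raise_of_card_ne (by omega)).symm

/-- `c` starts no infinite execution. -/
def Terminates (μo : Fin K → ℤ) (c : Config K) : Prop :=
  Acc (fun c' c => Step μo c c') c

theorem terminates_halted (μo : Fin K → ℤ) (θ : Bundle K → ℤ) (μ : Fin K → ℤ) :
    Terminates μo (.halted θ μ) :=
  Acc.intro _ fun _ h => nomatch h

theorem terminates_part3 (μo : Fin K → ℤ) (n : ℕ) :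
    ∀ (todo : Finset (Fin K)) (θ : Bundle K → ℤ) (μ : Fin K → ℤ), todo.card = n →
      Terminates μo (.part3 todo θ μ) := by
  induction n with
  | zero =>
    intro todo θ μ hn
    refine Acc.intro _ fun c hc => ?_
    cases hc with
    | setMu _ _ _ k hk => simp [Finset.card_eq_zero.mp hn] at hk
    | halt => exact terminates_halted μo _ _
  | succ n ih =>
    intro todo θ μ hn
    refine Acc.intro _ fun c hc => ?_
    cases hc with
    | setMu _ _ _ k hk => exact ih _ _ _ (by rw [Finset.card_erase_of_mem hk, hn]; rfl)
    | halt => simp at hn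

/-- The total amount by which `θ` may still rise below `U`. -/
def slack (U θ : Bundle K → ℤ) : ℕ := ∑ B, (U B - θ B).toNat

theorem slack_lt {U θ η : Bundle K → ℤ} (h : ∀ B, θ B ≤ η B) (hη : ∀ B, η B ≤ U B) (hne : η ≠ θ) :
    slack U η < slack U θ := by
  obtain ⟨B, hB⟩ := Function.ne_iff.mp hne
  refine Finset.sum_lt_sum (fun C _ => ?_) ⟨B, Finset.mem_univ B, ?_⟩
  · have := h C; omega
  · have := h B; have := hη B; omega

/-- Lexicographic descent on `2 * slack U θ + changed.toNat`, then on the number of remaining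
statements. The factor 2 lets a real change pay for setting the flag; a restart clears the flag, and
an idle statement only shrinks `todo`. -/
theorem terminates_part2 {θo : Bundle K → ℤ} (μo : Fin K → ℤ) {L : ℕ}
    (hnext : ∀ θ, PhaseInv θo (L + 1) θ → Terminates μo (enterPhase μo (L + 1) θ))
    {U : Bundle K → ℤ} (hU : ∀ A i j k, (A, i, j, k) ∈ tripleTasks K L → TripleIneq U A i j k)
    (s n : ℕ) (todo : Finset (Bundle K × Fin K × Fin K × Fin K)) (changed : Bool)
    (θ : Bundle K → ℤ) (hs : 2 * slack U θ + changed.toNat = s) (hn : todo.card = n)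
    (hinv : Inv θo μo (.part2 L todo changed θ)) (hle : ∀ B, θ B ≤ U B)
    (heq : ∀ B : Bundle K, B.card ≠ L → U B = θ B) :
    Terminates μo (.part2 L todo changed θ) := by
  induction s using Nat.strong_induction_on generalizing n todo changed θ with
  | _ s ihs =>
  induction n using Nat.strong_induction_on generalizing todo changed θ with
  | _ n ihn =>
  refine Acc.intro _ fun c hc => ?_
  have hinv' := hinv.step hc
  cases hc with
  | triple _ _ _ _ t ht =>
    have ht' := hinv.2.2.1 ht
    obtain ⟨hle', heq'⟩ := tripleUpdate_le hle heq hU ht'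
    by_cases hne : tripleUpdate θ t = θ
    · rw [hne] at hinv' ⊢
      simp only [ne_eq, not_true_eq_false, decide_false, Bool.or_false] at hinv' ⊢
      exact ihn _ (by rw [← hn]; exact Finset.card_erase_lt_of_mem ht) _ _ _ hs rfl hinv' hle heq
    · have hlt : slack U (tripleUpdate θ t) < slack U θ := slack_lt (le_raise _ _ _) hle' hne
      have hb := Bool.toNat_le (changed || decide (tripleUpdate θ t ≠ θ))
      have hb' : (true : Bool).toNat = 1 := rfl
      rcases changed with _ | _
      · simp only [Bool.toNat_false] at hs
        exact ihs _ (by omega) _ _ _ _ rfl rfl hinv' hle' heq'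
      · exact ihs _ (by omega) _ _ _ _ rfl rfl hinv' hle' heq'
  | again =>
    exact ihs _ (by rw [← hs]; simp) _ _ _ _ rfl rfl hinv' hle heq
  | phaseDone =>
    obtain ⟨-, h, -, hpair, hdone⟩ := hinv
    exact hnext θ (h.succ hpair fun A i j k hm => hdone rfl A i j k hm (by simp))

theorem terminates_part1 {θo : Bundle K → ℤ} (μo : Fin K → ℤ) {L : ℕ}
    (hnext : ∀ θ, PhaseInv θo (L + 1) θ → Terminates μo (enterPhase μo (L + 1) θ))
    (n : ℕ) : ∀ (todo : Finset (Bundle K × Fin K × Fin K)) (θ : Bundle K → ℤ), todo.card = n →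
      Inv θo μo (.part1 L todo θ) → Terminates μo (.part1 L todo θ) := by
  induction n with
  | zero =>
    intro todo θ hn hinv
    refine Acc.intro _ fun c hc => ?_
    have hinv' := hinv.step hc
    cases hc with
    | pair _ _ _ t ht => simp [Finset.card_eq_zero.mp hn] at ht
    | pairsDone =>
      obtain ⟨U, hle, heq, hU⟩ := hinv.2.1.exists_bound
      exact terminates_part2 μo hnext hU _ _ _ _ _ rfl rfl hinv' hle heq
  | succ n ih =>
    intro todo θ hn hinv
    refine Acc.intro _ fun c hc => ?_
    have hinv' := hinv.step hc
    cases hc with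
    | pair _ _ _ t ht => exact ih _ _ (by rw [Finset.card_erase_of_mem ht, hn]; rfl) hinv'
    | pairsDone => simp at hn

theorem terminates_enterPhase {θo : Bundle K → ℤ} (μo : Fin K → ℤ) (n : ℕ) :
    ∀ (L : ℕ) (θ : Bundle K → ℤ), K + 1 - L = n → PhaseInv θo L θ →
      Terminates μo (enterPhase μo L θ) := by
  induction n with
  | zero =>
    intro L θ hn h
    rw [enterPhase, if_neg (by omega)]
    exact terminates_part3 μo _ _ _ _ rfl
  | succ n ih =>
    intro L θ hn h
    have hinv := inv_enterPhase μo h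
    rw [enterPhase, if_pos (by omega)] at hinv ⊢
    exact terminates_part1 μo (fun η hη => ih (L + 1) η (by omega) hη) _ _ _ rfl hinv

theorem Terminates.not_infinite {μo : Fin K → ℤ} {c : Config K} (hc : Terminates μo c) :
    ∀ run : ℕ → Config K, run 0 = c → ¬ ∀ n, Step μo (run n) (run (n + 1)) := by
  induction hc with
  | intro c _ ih =>
    rintro run rfl hrun
    exact ih (run 1) (hrun 0) (fun n => run (n + 1)) rfl fun n => hrun (n + 1)

theorem exists_step_or_halted (μo : Fin K → ℤ) (c : Config K) :
    (∃ c', Step μo c c') ∨ ∃ θ μ, c = Config.halted θ μ := by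
  cases c with
  | part1 L todo θ =>
    left
    rcases todo.eq_empty_or_nonempty with rfl | ⟨t, ht⟩
    · exact ⟨_, .pairsDone L θ⟩
    · exact ⟨_, .pair L todo θ t ht⟩
  | part2 L todo changed θ =>
    left
    rcases todo.eq_empty_or_nonempty with rfl | ⟨t, ht⟩
    · cases changed
      · exact ⟨_, .phaseDone L θ⟩
      · exact ⟨_, .again L θ⟩
    · exact ⟨_, .triple L todo changed θ t ht⟩
  | part3 todo θ μ =>
    left
    rcases todo.eq_empty_or_nonempty with rfl | ⟨k, hk⟩
    · exact ⟨_, .halt θ μ⟩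
    · exact ⟨_, .setMu todo θ μ k hk⟩
  | halted θ μ => exact Or.inr ⟨θ, μ, rfl⟩

/-! ### Properties of the output -/

section Output

variable {θo θ : Bundle K → ℤ} {L : ℕ}

theorem PhaseInv.pairIneq (h : PhaseInv θo L θ) (hL : K < L) {A : Bundle K} {i j : Fin K}
    (hi : i ∉ A) (hj : j ∉ A) (hij : i ≠ j) : PairIneq θ A i j := by
  have h1 := Finset.card_le_univ (insert i (insert j A))
  rw [card_insert_insert hi hj hij, Fintype.card_fin] at h1
  exact h.pair A i j (by omega) hi hj hij

theorem PhaseInv.tripleIneq (h : PhaseInv θo L θ) (hL : K < L) {A : Bundle K} {i j k : Fin K}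
    (hi : i ∉ A) (hj : j ∉ A) (hk : k ∉ A) (hij : i ≠ j) (hik : i ≠ k) (hjk : j ≠ k) :
    TripleIneq θ A i j k := by
  have h1 := Finset.card_le_univ (insert i (insert j A))
  rw [card_insert_insert hi hj hij, Fintype.card_fin] at h1
  exact h.triple A i j k (by omega) hi hj hk hij hik hjk

theorem PhaseInv.localExchange_neg (h : PhaseInv θo L θ) (hL : K < L) :
    LocalExchange fun A => -(θ A : ℝ) where
  pair A i j hi hj hij := by
    have := h.pairIneq hL hi hj hij
    unfold PairIneq at this
    norm_cast
    omega
  triple A i j k hi hj hk hij hik hjk := by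
    have := h.tripleIneq hL hi hj hk hij hik hjk
    unfold TripleIneq at this
    norm_cast
    omega

/-- Reads `μ` as negated prices, so that `LocalExchange.payoff` applies; that lemma needs no sign
condition on prices. -/
theorem outputValuation_eq_payoff (θ : Bundle K → ℤ) (μ : Fin K → ℤ) :
    outputValuation θ μ = payoff (fun A => -(θ A : ℝ)) fun k => -(μ k : ℝ) := by
  funext A
  simp only [outputValuation, payoff, Finset.sum_neg_distrib]
  ring

theorem PhaseInv.isSubstituteValuation (h : PhaseInv θo L θ) (hL : K < L) (μ : Fin K → ℤ) :
    IsSubstituteValuation (outputValuation θ μ) := by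
  have h0 : outputValuation θ μ ∅ = 0 := by simp [outputValuation, h.small ∅ (by simp)]
  rw [outputValuation_eq_payoff] at h0 ⊢
  exact ((h.localExchange_neg hL).payoff _).isSubstituteValuation h0

theorem monotone_outputValuation {μo μ : Fin K → ℤ}
    (hμ : ∀ k, μ k = max (μo k) (maxMarginal θ k)) : Monotone (outputValuation θ μ) := by
  refine Finset.monotone_iff_forall_le_insert.mpr fun A k hk => ?_
  have h1 : θ (insert k A) - θ A ≤ maxMarginal θ k :=
    Finset.le_sup' (fun A => θ (insert k A) - θ A) (by simp [bundlesWithout, hk])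
  have h2 : θ (insert k A) - θ A ≤ μ k := by rw [hμ k]; exact h1.trans (le_max_right _ _)
  have h3 : (θ (insert k A) : ℝ) - θ A ≤ μ k := by exact_mod_cast h2
  simp only [outputValuation, Finset.sum_insert hk]
  linarith

theorem PhaseInv.mem_feasible (h : PhaseInv θo L θ) (hL : K < L) :
    toReal θ ∈ Feasible (toReal θo) := by
  refine ⟨fun A hA => by simp [toReal, h.small A hA],
    isSupermodular_of_pair fun A i j hi hj hij => ?_, ?_,
    fun A => by simpa [toReal] using h.ge A⟩
  · have := h.pairIneq hL hi hj hij
    unfold PairIneq at this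
    simp only [toReal]
    norm_cast
    omega
  · intro M _ _ A i j k _ hi hj hk hij hik hjk
    -- The three inequalities of `DoubleMin` are one triple inequality with each good in turn
    -- singled out.
    have h1 := h.tripleIneq hL hi hj hk hij hik hjk
    have h2 := h.tripleIneq hL hi hk hj hik hij hjk.symm
    have h3 := h.tripleIneq hL hj hk hi hjk hij.symm hik.symm
    unfold TripleIneq at h1 h2 h3
    rw [Finset.insert_comm k j] at h2
    rw [Finset.insert_comm k i, Finset.insert_comm j i] at h3
    simp only [toReal, DoubleMin]
    norm_cast
    omega

theorem PhaseInv.levelLexLE (h : PhaseInv θo L θ) {θ' : Bundle K → ℝ}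
    (hθ' : θ' ∈ Feasible (toReal θo)) : LevelLexLE (toReal θ) θ' := by
  by_cases heq : toReal θ = θ'
  · exact Or.inl heq
  right
  classical
  have hex : ∃ n, ∃ A : Bundle K, A.card = n ∧ toReal θ A ≠ θ' A := by
    obtain ⟨A, hA⟩ := Function.ne_iff.mp heq
    exact ⟨_, A, rfl, hA⟩
  obtain ⟨A, hA, hne⟩ := Nat.find_spec hex
  have hlow : ∀ B : Bundle K, B.card < Nat.find hex → toReal θ B = θ' B := by
    intro B hB
    by_contra hB'
    exact Nat.find_min hex hB ⟨B, rfl, hB'⟩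
  have hle := h.minimal θ' hθ' _ hlow
  refine ⟨Nat.find hex, ?_, ?_, hlow, hle, A, hA, lt_of_le_of_ne (hle A hA) hne⟩
  -- Both functions vanish on bundles of size at most one, so they first differ at level 2 or later.
  · by_contra hlt
    have hcard : A.card ≤ 1 := by omega
    exact hne (by rw [hθ'.1 A hcard]; simp [toReal, h.small A hcard])
  · rw [← hA]; simpa using Finset.card_le_univ A

theorem LevelLexLE.antisymm {θ θ' : Bundle K → ℝ} (h : LevelLexLE θ θ') (h' : LevelLexLE θ' θ) :
    θ' = θ := by
  rcases h with h | ⟨L, -, -, hlow, hle, A, hA, hlt⟩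
  · exact h.symm
  rcases h' with h' | ⟨M, -, -, hlow', hle', A', hA', hlt'⟩
  · exact h'
  exfalso
  rcases lt_trichotomy L M with hLM | rfl | hLM
  · linarith [hlow' A (by omega)]
  · linarith [hle' A hA]
  · linarith [hlow A' (by omega)]

end Output

end SubstituteGen

theorem mainTheorem2 (K : ℕ) (θo : SubstituteGen.Bundle K → ℤ) (μo : Fin K → ℤ)
    (hθo : SubstituteGen.IsInteractionFunction (SubstituteGen.toReal θo)) :
    -- no execution is infinite
    (¬ ∃ run : ℕ → SubstituteGen.Config K,
        run 0 = SubstituteGen.start θo μo ∧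
          ∀ n, SubstituteGen.Step μo (run n) (run (n + 1))) ∧
    -- an execution only stops by halting with an output
    (∀ c, SubstituteGen.Reachable θo μo c →
        (∃ c', SubstituteGen.Step μo c c') ∨ ∃ θ μ, c = SubstituteGen.Config.halted θ μ) ∧
    -- every output has the stated properties
    (∀ (θ : SubstituteGen.Bundle K → ℤ) (μ : Fin K → ℤ),
        SubstituteGen.Reachable θo μo (SubstituteGen.Config.halted θ μ) →
          SubstituteGen.IsSubstituteValuation (SubstituteGen.outputValuation θ μ) ∧
          Monotone (SubstituteGen.outputValuation θ μ) ∧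
          SubstituteGen.toReal θ ∈ SubstituteGen.Feasible (SubstituteGen.toReal θo) ∧
          ∀ θ' ∈ SubstituteGen.Feasible (SubstituteGen.toReal θo),
            SubstituteGen.LevelLexLE (SubstituteGen.toReal θ) θ' ∧
            (SubstituteGen.LevelLexLE θ' (SubstituteGen.toReal θ) →
              θ' = SubstituteGen.toReal θ)) := by
  refine ⟨?_, fun c _ => SubstituteGen.exists_step_or_halted μo c, ?_⟩
  · rintro ⟨run, h0, hrun⟩
    have hstart := SubstituteGen.phaseInv_start hθo
    exact (SubstituteGen.terminates_enterPhase μo _ 2 θo rfl hstart).not_infinite run h0 hrun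
  · intro θ μ hreach
    obtain ⟨⟨L, hL, h⟩, hμ⟩ := SubstituteGen.inv_of_reachable hθo hreach
    exact ⟨h.isSubstituteValuation hL μ, SubstituteGen.monotone_outputValuation hμ,
      h.mem_feasible hL, fun θ' hθ' => ⟨h.levelLexLE hθ', (h.levelLexLE hθ').antisymm⟩⟩
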